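/- **Setting.** Let $\mathbf X_d\in\mathbb R^{N\times T}$, $d=1,\dots,D$, be the features of a discrete-time dynamic graph with $N$ nodes, valid times $t=0,\dots,T-1$, and a fixed symmetric non-negative adjacency matrix with normalized Laplacian $\hat{\mathbf L}$ (with $\mathbf D^{-1/2}$ taken to be $0$ at nodes of degree $0$). Let $P_0,\dots,P_K$ be real polynomials, and let $\Theta_{k,d}$ be real coefficients. For each $d$ let $\mathbf H_d\in\mathbb R^{N\times T}$ be the desired node embeddings. Let $\mathbf F\in\mathbb C^{T\times T}$ be a linear orthogonal space projector: $\mathbf F\mathbf F^{*}=\alpha\mathbf I$ for some $\alpha>0$ (for instance a unitary matrix, or the discrete Fourier matrix with $\alpha=T$). It acts on each univariate series (row) by right multiplication. Put $\mathbf A_d=\mathbf H_d\mathbf F$. All matrix norms are Frobenius norms and $M_n$ denotes the $n$-th row of $M$. *Full-order individual linear spectral filters* are matrices $\mathbf W_{n}\in\mathbb C^{T\times T}$, one for each variable $n$; they send $\mathbf H_d$ to the matrix $\mathcal T_{\mathbf W}(\mathbf H_d)$ whose $n$-th row is $(\mathbf A_d)_n\mathbf W_n\mathbf F^{-1}$.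 *Reduced-order* filters use only $S\le T$ components $I=\{i_0<\dots<i_{S-1}\}$, with $0$-$1$ masking matrix $\mathbf S_I\in\{0,1\}^{S\times T}$, and have weights $\Phi_n\in\mathbb C^{S\times T}$. The linear spectral-temporal graph neural network with these filters outputs, in dimension $d$, the matrix $\mathbf Z_d(I,\Phi)$ whose $n$-th row is $$\Big(\big(\textstyle\sum_{k=0}^{K}\Theta_{k,d}P_k(\hat{\mathbf L})\mathbf X_d\big)\mathbf F\,\mathbf S_I^{\top}\Big)_n\Phi_n\,\mathbf F^{-1}.$$ For a singular value decomposition of $\mathbf A_d$ with $\min(N,T)$ singular values in non-increasing order, let $\mathbf A_{d,k}$ be the truncation to the $k$ largest singular values, and let the coherence $\mu_k(\mathbf A_d)$ be the largest squared Euclidean norm of a row of the matrix whose columns are the first $k$ right singular vectors. **Theorem.** For all $c>0$ and $\delta\in(0,1)$ there is $C>0$, depending only on $c$ and $\delta$, such that the following holds for all $N,T,D,K,k,S$, all data as above, all singular value decompositions of the $\mathbf A_d$, and all $\varepsilon\in(0,1]$. Assume that * the node embeddings are accurate in each snapshot: $\big(\sum_{k}\Theta_{k,d}P_k(\hat{\mathbf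 L})\mathbf X_d\big)_{n,t}=(\mathbf H_d)_{n,t}$ for all $d,n,t$; * $\mu_k(\mathbf A_d)\le c\,k/T$ for every $d$; * $C k^2/\varepsilon^2\le S\le T$. For each $d$ let $\eta_d=(1+\varepsilon)\,\|\mathbf A_d-\mathbf A_{d,k}\|_F/\sqrt\alpha$. Call a selection $I$ *good for $d$* if, with $\mathbf A'=\mathbf A_d\mathbf S_I^{\top}$ and its Moore–Penrose inverse $\mathbf A'^{\dagger}$: 1. for every $B\ge 0$ and all full-order individual filters with $\|\mathbf W_n\|_F\le B$ for all $n$, the reduced-order filters $\Phi_n=\mathbf A'^{\dagger}\mathbf A_d\mathbf W_n$ satisfy $\|\mathcal T_{\mathbf W}(\mathbf H_d)-\mathbf Z_d(I,\Phi)\|_F\le B\,\eta_d$; 2. for every $B\ge0$ and every target representation $\mathbf Y\in\mathbb C^{N\times T}$ with $\|\mathbf Y_n\|_2\le B\,\|(\mathbf H_d)_n\|_2$ for all $n$, there are full-order individual filters with $\|\mathbf W_n\|_F\le B$ for all $n$ and $\mathcal T_{\mathbf W}(\mathbf H_d)=\mathbf Y$, and with $\Phi_n=\mathbf A'^{\dagger}\mathbf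 A_d\mathbf W_n$ one has $\|\mathbf Y-\mathbf Z_d(I,\Phi)\|_F\le B\,\eta_d$. The norms in 1 and 2 run over all nodes and all valid times, so in particular the same bounds hold at each valid time. Then for each $d$, a uniformly random $S$-element selection is good for $d$ with probability at least $1-\delta$; and if selections $I_1,\dots,I_D$ are drawn independently and uniformly, then with probability at least $(1-\delta)^D$ each $I_d$ is good for $d$ simultaneously. -/

import Mathlib

open scoped Matrix

/- Throughout, `‖M‖` for a matrix `M` is the Frobenius norm. -/
attribute [local instance] Matrix.frobeniusNormedAddCommGroup

namespace SPTGNN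

/-- A multivariate time series with `N` variables, `T` time steps and `D` feature dimensions, seen
as a discrete-time dynamic graph: a fixed undirected weighted topology `adj`, and node features
`X d n t` (dimension `d`, node `n`, time `t`). The valid times are the elements of `Fin T`. -/
structure DynGraph (N T D : ℕ) where
  adj : Matrix (Fin N) (Fin N) ℝ
  adj_symm : adj.IsSymm
  adj_nonneg : ∀ i j, 0 ≤ adj i j
  X : Fin D → Matrix (Fin N) (Fin T) ℝ

/-- The degree of a node. -/
def DynGraph.degree {N T D : ℕ} (G : DynGraph N T D) (i : Fin N) : ℝ :=
  ∑ j, G.adj i j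

/-- The normalized graph Laplacian `D^(-1/2) (D - A) D^(-1/2)`, with the usual convention that
`D^(-1/2)` is `0` at a node of degree `0`. -/
noncomputable def DynGraph.normLaplacian {N T D : ℕ} (G : DynGraph N T D) :
    Matrix (Fin N) (Fin N) ℝ :=
  Matrix.diagonal (fun i => (√(G.degree i))⁻¹) * (Matrix.diagonal G.degree - G.adj) *
    Matrix.diagonal (fun i => (√(G.degree i))⁻¹)

/-- The graph spectral filter `∑ k ≤ K, θ k • P k (L)` for a family of polynomials `P`. -/
noncomputable def graphFilter {N K : ℕ} (P : Fin (K + 1) → Polynomial ℝ) (θ : Fin (K + 1) → ℝ)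
    (L : Matrix (Fin N) (Fin N) ℝ) : Matrix (Fin N) (Fin N) ℝ :=
  ∑ k, θ k • Polynomial.aeval L (P k)

/-- The node embeddings `g_θ(L) X_d` in dimension `d`; column `t` is the snapshot at time `t`. -/
noncomputable def DynGraph.nodeEmbedding {N T D K : ℕ} (G : DynGraph N T D)
    (P : Fin (K + 1) → Polynomial ℝ) (θ : Fin (K + 1) → ℝ) (d : Fin D) :
    Matrix (Fin N) (Fin T) ℝ :=
  graphFilter P θ G.normLaplacian * G.X d

/-- A linear orthogonal space projector on series of length `T`, possibly complex: a matrix whose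
rows are pairwise orthogonal of common squared norm `scale`. Unitary matrices are the case
`scale = 1`, the unnormalized discrete Fourier transform is the case `scale = T`. -/
structure OrthogonalProjector (T : ℕ) where
  mat : Matrix (Fin T) (Fin T) ℂ
  scale : ℝ
  scale_pos : 0 < scale
  orthogonal : mat * matᴴ = (scale : ℂ) • (1 : Matrix (Fin T) (Fin T) ℂ)

/-- Forward projection of each row (each univariate series) of `Z`. -/
def OrthogonalProjector.forward {N T : ℕ} (F : OrthogonalProjector T)
    (Z : Matrix (Fin N) (Fin T) ℂ) : Matrix (Fin N) (Fin T) ℂ :=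
  Z * F.mat

/-- Inverse projection of each row of `A`. -/
noncomputable def OrthogonalProjector.inverse {N T : ℕ} (F : OrthogonalProjector T)
    (A : Matrix (Fin N) (Fin T) ℂ) : Matrix (Fin N) (Fin T) ℂ :=
  A * F.mat⁻¹

/-- The spectral components of the real series forming the rows of `H`. -/
noncomputable def OrthogonalProjector.spectral {N T : ℕ} (F : OrthogonalProjector T)
    (H : Matrix (Fin N) (Fin T) ℝ) : Matrix (Fin N) (Fin T) ℂ :=
  F.forward (H.map Complex.ofReal)

/-- A selection of `S` of the `T` spectral components, as a list of increasing indices. -/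
abbrev Mask (S T : ℕ) : Type := Fin S ↪o Fin T

/-- The `0`-`1` masking matrix of a selection. -/
def maskMatrix {S T : ℕ} (I : Mask S T) : Matrix (Fin S) (Fin T) ℂ :=
  Matrix.of fun s t => if t = I s then 1 else 0

/-- The retained components `A' = A Sᵀ`. -/
def sampleColumns {N S T : ℕ} (A : Matrix (Fin N) (Fin T) ℂ) (I : Mask S T) :
    Matrix (Fin N) (Fin S) ℂ :=
  A * (maskMatrix I)ᵀ

/-- Individual linear spectral filters: row `n` of `A` is multiplied by its own matrix `W n`. -/
def applyFilters {N R T : ℕ} (A : Matrix (Fin N) (Fin R) ℂ)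
    (W : Fin N → Matrix (Fin R) (Fin T) ℂ) : Matrix (Fin N) (Fin T) ℂ :=
  Matrix.of fun n => A n ᵥ* W n

/-- Temporal frequency-domain model with full-order individual linear filters. -/
noncomputable def fullFDM {N T : ℕ} (F : OrthogonalProjector T) (H : Matrix (Fin N) (Fin T) ℝ)
    (W : Fin N → Matrix (Fin T) (Fin T) ℂ) : Matrix (Fin N) (Fin T) ℂ :=
  F.inverse (applyFilters (F.spectral H) W)

/-- Temporal frequency-domain model with reduced-order individual linear filters: project, keep the
components selected by `I`, filter each row with its own matrix, project back. -/
noncomputable def reducedFDM {N S T : ℕ} (F : OrthogonalProjector T)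
    (H : Matrix (Fin N) (Fin T) ℝ) (I : Mask S T) (Φ : Fin N → Matrix (Fin S) (Fin T) ℂ) :
    Matrix (Fin N) (Fin T) ℂ :=
  F.inverse (applyFilters (sampleColumns (F.spectral H) I) Φ)

/-- Output in dimension `d` of the linear spectral-temporal graph neural network
`Z_d = T_φ (∑ k, θ k P_k(L) X_d)`, with a reduced-order linear temporal model `T_φ`. -/
noncomputable def DynGraph.model {N T D K S : ℕ} (G : DynGraph N T D)
    (P : Fin (K + 1) → Polynomial ℝ) (θ : Fin (K + 1) → ℝ) (F : OrthogonalProjector T)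
    (d : Fin D) (I : Mask S T) (Φ : Fin N → Matrix (Fin S) (Fin T) ℂ) :
    Matrix (Fin N) (Fin T) ℂ :=
  reducedFDM F (G.nodeEmbedding P θ d) I Φ

/-- A singular value decomposition `A = U diag(σ) Vᴴ` with non-increasing singular values. -/
structure SVD {N T : ℕ} (A : Matrix (Fin N) (Fin T) ℂ) where
  U : Matrix (Fin N) (Fin (min N T)) ℂ
  σ : Fin (min N T) → ℝ
  V : Matrix (Fin T) (Fin (min N T)) ℂ
  U_orthonormal : Uᴴ * U = 1
  V_orthonormal : Vᴴ * V = 1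
  σ_nonneg : ∀ i, 0 ≤ σ i
  σ_antitone : Antitone σ
  eq_mul : A = U * Matrix.diagonal (fun i => (σ i : ℂ)) * Vᴴ

/-- The truncation `A_k` of `A` to its `k` largest singular values. -/
noncomputable def SVD.truncate {N T : ℕ} {A : Matrix (Fin N) (Fin T) ℂ} (s : SVD A) (k : ℕ) :
    Matrix (Fin N) (Fin T) ℂ :=
  s.U * Matrix.diagonal (fun i : Fin (min N T) => if i.val < k then (s.σ i : ℂ) else 0) * s.Vᴴ

/-- The (rank-`k`) coherence of `A` with respect to its columns: the largest leverage score, i.e.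
the largest squared norm of a row of the matrix of the top `k` right singular vectors. -/
noncomputable def SVD.coherence {N T : ℕ} {A : Matrix (Fin N) (Fin T) ℂ} (s : SVD A) (k : ℕ) : ℝ :=
  ⨆ t : Fin T, ∑ i with (i : Fin (min N T)).val < k, ‖s.V t i‖ ^ 2

/-- `X` is the Moore-Penrose inverse of `M`. -/
structure IsMoorePenrose {m n : ℕ} (M : Matrix (Fin m) (Fin n) ℂ)
    (X : Matrix (Fin n) (Fin m) ℂ) : Prop where
  mul_mul_left : M * X * M = M
  mul_mul_right : X * M * X = X
  isHermitian_left : (M * X).IsHermitian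
  isHermitian_right : (X * M).IsHermitian

/-- Probability of the event `E` under the uniform distribution on the finite type `Ω`. -/
noncomputable def uniformProb {Ω : Type} (E : Set Ω) : ℝ :=
  (Nat.card E : ℝ) / (Nat.card Ω : ℝ)

/-- The linear network, with the components of dimension `d` selected by `I`, is expressive up to
error level `η` with respect to the embeddings `H`. Let `A` be the spectral form of `H` and
`A'` its retained columns. The reduced-order weights are `A'† A W n`, so that applied to `A'` with
a common `W` they give `P_{A'}(A) W = A' A'† A W`.
First clause: these reproduce every family of full-order individual linear filters.
Second clause: every target series `Y`, normalized by `‖Y n‖ ≤ B ‖H n‖` for each variable `n`, is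
produced exactly by full-order filters bounded by `B`, and by the reduced-order network up to
`B * η`. All errors are taken over all nodes and all valid times together. -/
def DynGraph.Expressive {N T D K S : ℕ} (G : DynGraph N T D)
    (P : Fin (K + 1) → Polynomial ℝ) (θ : Fin (K + 1) → ℝ) (F : OrthogonalProjector T)
    (H : Matrix (Fin N) (Fin T) ℝ) (d : Fin D) (η : ℝ) (I : Mask S T) : Prop :=
  ∃ A'pinv : Matrix (Fin S) (Fin N) ℂ, IsMoorePenrose (sampleColumns (F.spectral H) I) A'pinv ∧
    (∀ (W : Fin N → Matrix (Fin T) (Fin T) ℂ) (B : ℝ), 0 ≤ B → (∀ n, ‖W n‖ ≤ B) →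
      ‖fullFDM F H W - G.model P θ F d I (fun n => A'pinv * F.spectral H * W n)‖ ≤ B * η) ∧
    (∀ (Y : Matrix (Fin N) (Fin T) ℂ) (B : ℝ), 0 ≤ B →
      (∀ n, ‖WithLp.toLp 2 (Y n)‖ ≤ B * ‖WithLp.toLp 2 (H n)‖) →
      ∃ W : Fin N → Matrix (Fin T) (Fin T) ℂ, (∀ n, ‖W n‖ ≤ B) ∧ fullFDM F H W = Y ∧
        ‖Y - G.model P θ F d I (fun n => A'pinv * F.spectral H * W n)‖ ≤ B * η)

end SPTGNN

/-! Everything reduces to one matrix statement: uniformly sampled columns of an incoherent `A` span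
a space whose orthogonal projection `A' A'†` leaves an error of at most `(1 + ε) ‖A - A_k‖`. The
reduced-order filters `A'† A W n` turn the output error into the filters `W n` applied to the
residual `A - A' A'† A` (`fullFDM_sub_reducedFDM`). One event on the selection therefore serves all
filters and targets at once, and the factor `1 / √α` comes from inverting the projector.

For the matrix statement, let `v` hold the top `k` right singular vectors and `R = A - A_k`, so `vᴴ
v = 1` and `R v = 0`. The rescaled sampled products estimate these two without bias. Because
inclusions of distinct indices are nonpositively correlated, the second moments are at most those of
independent inclusion, and coherence bounds them (`sum_sq_sampledMul_sub_le`). Markov's inequality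
makes both estimates accurate with probability `1 - δ`. A competitor that reproduces `A_k` exactly
then bounds the projection error (`SVD.norm_sub_le_of_sampledMul`).

Exact targets come from rank-one filters (`exists_fullFDM_eq`), and independence across dimensions
multiplies the probabilities. -/

namespace SPTGNN

/-! ### Uniform sampling without replacement -/

/-- The set of retained indices of a selection. -/
def Mask.support {S T : ℕ} (I : Mask S T) : Finset (Fin T) :=
  Finset.univ.map I.toEmbedding

lemma Mask.card_support {S T : ℕ} (I : Mask S T) : I.support.card = S := by
  simp [Mask.support]

/-- An increasing selection is determined by its image, so this is a count of `S`-subsets. The cases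
`u.card = 0, 1, 2` give the total count and the first two moments of the inclusion indicators. -/
lemma Mask.card_support_superset {S T : ℕ} (u : Finset (Fin T)) (hu : u.card ≤ S) :
    (Finset.univ.filter fun I : Mask S T => u ⊆ I.support).card =
      (T - u.card).choose (S - u.card) := by
  have h := Finset.card_filter_powersetCard_subset u Finset.univ S (Finset.subset_univ u) hu
  rw [Finset.card_univ, Fintype.card_fin] at h
  rw [← h]
  refine Finset.card_bij (fun I _ => I.support) ?_ ?_ ?_
  · intro I hI
    have hI' := (Finset.mem_filter.1 hI).2
    simp [hI', Finset.mem_powersetCard, Mask.card_support]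
  · intro I _ J _ hIJ
    apply Set.powersetCard.ofFinEmbEquiv.injective
    exact Subtype.ext hIJ
  · intro s hs
    simp only [Finset.mem_filter, Finset.mem_powersetCard] at hs
    have key : Mask.support (s.orderEmbOfFin hs.1.2) = s := by
      ext x
      simp [Mask.support]
    exact ⟨s.orderEmbOfFin hs.1.2, by simp [key, hs.2], key⟩

lemma Mask.card_eq_choose (S T : ℕ) : Fintype.card (Mask S T) = T.choose S := by
  simpa using Mask.card_support_superset (S := S) (T := T) ∅ (by simp)

lemma Mask.sum_support {S T : ℕ} (I : Mask S T) {M : Type*} [AddCommMonoid M] (f : Fin T → M) :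
    ∑ s, f (I s) = ∑ t, if t ∈ I.support then f t else 0 := by
  rw [← Finset.sum_filter, Finset.filter_mem_eq_inter, Finset.univ_inter, Mask.support,
    Finset.sum_map]
  rfl

lemma Mask.card_mem {S T : ℕ} (hS : 0 < S) (t : Fin T) :
    (T : ℝ) * (Finset.univ.filter fun I : Mask S T => t ∈ I.support).card =
      S * Fintype.card (Mask S T) := by
  have h := Mask.card_support_superset (S := S) {t} (by rw [Finset.card_singleton]; exact hS)
  simp only [Finset.singleton_subset_iff, Finset.card_singleton] at h
  rw [h, Mask.card_eq_choose]
  obtain ⟨s, rfl⟩ : ∃ s, S = s + 1 := ⟨S - 1, by omega⟩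
  obtain ⟨m, rfl⟩ : ∃ m, T = m + 1 := ⟨T - 1, by have := t.2; omega⟩
  have := Nat.add_one_mul_choose_eq m s
  simp only [Nat.add_sub_cancel]
  rw [mul_comm ((s + 1 : ℕ) : ℝ)]
  exact_mod_cast this

/-- The number of selections that contain two given distinct indices. -/
def Mask.pairCount (S T : ℕ) : ℕ := if 2 ≤ S then (T - 2).choose (S - 2) else 0

lemma Mask.card_mem_mem {S T : ℕ} {t u : Fin T} (htu : t ≠ u) :
    (Finset.univ.filter fun I : Mask S T => t ∈ I.support ∧ u ∈ I.support).card =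
      Mask.pairCount S T := by
  have e : ∀ I : Mask S T, (t ∈ I.support ∧ u ∈ I.support) ↔ {t, u} ⊆ I.support := by
    intro I
    simp [Finset.insert_subset_iff]
  have hc : ({t, u} : Finset (Fin T)).card = 2 := Finset.card_pair htu
  simp only [e, Mask.pairCount]
  split_ifs with h
  · rw [Mask.card_support_superset _ (by omega), hc]
  -- For `S < 2` the truncated `S - 2` would make the binomial coefficient `1`, hence the case split
  -- in `Mask.pairCount`.
  · rw [Finset.card_eq_zero, Finset.filter_eq_empty_iff]
    intro I _ hI
    have := Finset.card_le_card hI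
    simp only [Mask.support, Finset.card_map, Finset.card_univ, Fintype.card_fin] at this
    omega

/-- Nonpositive correlation of sampling without replacement: `S (S - 1) / (T (T - 1)) ≤ (S / T) ^
2`. -/
lemma Mask.sq_mul_pairCount_le {S T : ℕ} (hST : S ≤ T) :
    (T : ℝ) ^ 2 * Mask.pairCount S T ≤ (S : ℝ) ^ 2 * Fintype.card (Mask S T) := by
  rw [Mask.pairCount, Mask.card_eq_choose]
  split_ifs with h
  · obtain ⟨s, rfl⟩ : ∃ s, S = s + 2 := ⟨S - 2, by omega⟩
    obtain ⟨m, rfl⟩ : ∃ m, T = m + 2 := ⟨T - 2, by omega⟩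
    simp only [Nat.add_sub_cancel]
    have h1 : ((m + 1 : ℕ) + 1 : ℝ) * (m + 1).choose (s + 1) =
        (m + 2).choose (s + 2) * ((s + 1 : ℕ) + 1) := by
      exact_mod_cast Nat.add_one_mul_choose_eq (m + 1) (s + 1)
    have h2 : ((m : ℝ) + 1) * m.choose s = (m + 1).choose (s + 1) * ((s : ℝ) + 1) := by
      exact_mod_cast Nat.add_one_mul_choose_eq m s
    have hsm : (s : ℝ) ≤ m := by exact_mod_cast (by omega : s ≤ m)
    push_cast at *
    have hm : (0 : ℝ) < m + 1 := by positivity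
    refine le_of_mul_le_mul_left ?_ hm
    set a : ℝ := ((m.choose s : ℕ) : ℝ)
    set b : ℝ := (((m + 1).choose (s + 1) : ℕ) : ℝ)
    set d : ℝ := (((m + 2).choose (s + 2) : ℕ) : ℝ)
    have hd : 0 ≤ d := by positivity
    calc ((m : ℝ) + 1) * ((m + 2) ^ 2 * a) = (m + 2) ^ 2 * ((m + 1) * a) := by ring
      _ = (m + 2) * (s + 1) * (((m : ℝ) + 1 + 1) * b) := by rw [h2]; ring
      _ = (m + 2) * (s + 1) * (d * (s + 2)) := by rw [h1]; ring
      _ = ((m + 2) * (s + 1)) * ((s + 2) * d) := by ring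
      _ ≤ ((m + 1) * (s + 2)) * ((s + 2) * d) := by
          gcongr ?_ * _
          nlinarith
      _ = _ := by ring
  · simp
    positivity

/-- Variance bound for the Horvitz–Thompson estimator of a sum. -/
lemma Mask.sum_sq_estimator_le {S T : ℕ} (hS : 0 < S) (hST : S ≤ T) (f : Fin T → ℂ) :
    ∑ I : Mask S T, ‖((T : ℂ) / S) * ∑ s, f (I s) - ∑ t, f t‖ ^ 2 ≤
      Fintype.card (Mask S T) * ((T : ℝ) / S * ∑ t, ‖f t‖ ^ 2) := by
  classical
  set r : ℝ := (T : ℝ) / S with hr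
  set w : Mask S T → Fin T → ℝ := fun I t => r * (if t ∈ I.support then 1 else 0) - 1 with hw
  set M : ℝ := ((Fintype.card (Mask S T) : ℕ) : ℝ) with hM
  have hS' : (S : ℝ) ≠ 0 := by positivity
  have hSpos : (0 : ℝ) < S := by positivity
  have hT' : (0 : ℝ) < T := by exact_mod_cast lt_of_lt_of_le hS hST
  have hrpos : 0 < r := by positivity
  have h1 : ∀ t, ∑ I : Mask S T, (if t ∈ I.support then (1 : ℝ) else 0) = S * M / T := by
    intro t
    rw [Finset.sum_boole, eq_div_iff hT'.ne', mul_comm]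
    exact Mask.card_mem hS t
  have h2 : ∀ t u, ∑ I : Mask S T, (if t ∈ I.support then (1 : ℝ) else 0) *
      (if u ∈ I.support then (1 : ℝ) else 0) =
      Mask.pairCount S T + (if t = u then S * M / T - Mask.pairCount S T else 0) := by
    intro t u
    split_ifs with htu
    · subst htu
      rw [add_sub_cancel, ← h1 t]
      exact Finset.sum_congr rfl fun I _ => by split_ifs <;> simp
    · have e : ∀ I : Mask S T, (if t ∈ I.support then (1 : ℝ) else 0) *
          (if u ∈ I.support then (1 : ℝ) else 0) =
          if t ∈ I.support ∧ u ∈ I.support then 1 else 0 := by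
        intro I
        by_cases h : t ∈ I.support <;> simp [h]
      simp_rw [e]
      rw [Finset.sum_boole, Mask.card_mem_mem htu, add_zero]
  -- The weights `w` are centred. Their covariance has one value off the diagonal and one on it, so
  -- the second moment collapses to a multiple of `‖∑ f‖ ^ 2` plus a multiple of `∑ ‖f‖ ^ 2`.
  have hcov : ∀ t u, ∑ I : Mask S T, w I t * w I u =
      (r ^ 2 * Mask.pairCount S T - M) +
        (if t = u then r * M - r ^ 2 * Mask.pairCount S T else 0) := by
    intro t u
    have e : ∀ I : Mask S T, w I t * w I u = r ^ 2 * ((if t ∈ I.support then (1 : ℝ) else 0) *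
      (if u ∈ I.support then (1 : ℝ) else 0)) - r * (if t ∈ I.support then (1 : ℝ) else 0)
      - r * (if u ∈ I.support then (1 : ℝ) else 0) + 1 := by
      intro I
      simp only [hw]
      ring
    simp_rw [e]
    rw [Finset.sum_add_distrib, Finset.sum_sub_distrib, Finset.sum_sub_distrib, ← Finset.mul_sum,
      ← Finset.mul_sum, ← Finset.mul_sum, h1, h1, h2]
    have : r * (S * M / T) = M := by rw [hr]; field_simp
    simp only [Finset.sum_const, Finset.card_univ, nsmul_eq_mul, mul_one, this, ← hM]
    split_ifs
    · linear_combination r * this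
    · ring
  have hest : ∀ I : Mask S T, ((T : ℂ) / S) * ∑ s, f (I s) - ∑ t, f t = ∑ t, (w I t : ℂ) * f t := by
    intro I
    rw [Mask.sum_support, Finset.mul_sum, ← Finset.sum_sub_distrib]
    refine Finset.sum_congr rfl fun t _ => ?_
    simp only [hw, hr]
    split_ifs <;> push_cast <;> ring
  have hsq : ∀ z : ℂ, ((‖z‖ ^ 2 : ℝ) : ℂ) = z * star z := by
    intro z
    simp [Complex.mul_conj, Complex.normSq_eq_norm_sq]
  have hmain : ∑ I : Mask S T, ‖((T : ℂ) / S) * ∑ s, f (I s) - ∑ t, f t‖ ^ 2 =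
      (r ^ 2 * Mask.pairCount S T - M) * ‖∑ t, f t‖ ^ 2 +
        (r * M - r ^ 2 * Mask.pairCount S T) * ∑ t, ‖f t‖ ^ 2 := by
    apply Complex.ofReal_injective
    have hI : ∀ I : Mask S T,
        ((‖((T : ℂ) / S) * ∑ s, f (I s) - ∑ t, f t‖ ^ 2 : ℝ) : ℂ) =
        ∑ t, ∑ u, ((w I t * w I u : ℝ) : ℂ) * (f t * star (f u)) := by
      intro I
      rw [hest, hsq, star_sum, Finset.sum_mul_sum]
      refine Finset.sum_congr rfl fun t _ => Finset.sum_congr rfl fun u _ => ?_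
      simp only [star_mul', Complex.star_def, Complex.conj_ofReal]
      push_cast
      ring
    rw [Complex.ofReal_sum]
    simp_rw [hI]
    rw [Finset.sum_comm]
    have : ∀ t, ∑ I : Mask S T, ∑ u, ((w I t * w I u : ℝ) : ℂ) * (f t * star (f u)) =
        ∑ u, ((r ^ 2 * Mask.pairCount S T - M : ℝ) : ℂ) * (f t * star (f u)) +
          ((r * M - r ^ 2 * Mask.pairCount S T : ℝ) : ℂ) * (f t * star (f t)) := by
      intro t
      rw [Finset.sum_comm]
      simp_rw [← Finset.sum_mul, ← Complex.ofReal_sum, hcov]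
      simp only [Complex.ofReal_add, add_mul, Finset.sum_add_distrib]
      congr 1
      rw [Finset.sum_eq_single t] <;> simp +contextual [eq_comm]
    simp_rw [this]
    rw [Finset.sum_add_distrib, ← Finset.mul_sum]
    simp_rw [← Finset.mul_sum]
    rw [← Finset.sum_mul, Complex.ofReal_add, Complex.ofReal_mul, Complex.ofReal_mul, hsq,
      Complex.ofReal_sum, star_sum]
    simp_rw [hsq]
  rw [hmain]
  -- Nonpositive correlation lets the `‖∑ f‖ ^ 2` term be dropped.
  have hle : r ^ 2 * Mask.pairCount S T - M ≤ 0 := by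
    have := Mask.sq_mul_pairCount_le hST
    rw [hr, div_pow, div_mul_eq_mul_div, sub_nonpos, div_le_iff₀ (by positivity)]
    linarith
  have hA : 0 ≤ ‖∑ t, f t‖ ^ 2 := by positivity
  have hB : 0 ≤ ∑ t, ‖f t‖ ^ 2 := by positivity
  have hC : 0 ≤ r ^ 2 * (Mask.pairCount S T : ℝ) := by positivity
  nlinarith [mul_nonneg hC hB]

/-! ### Frobenius norms -/

section Frobenius

variable {l m n : Type*} [Fintype l] [Fintype m] [Fintype n]

lemma frobenius_sq (M : Matrix m n ℂ) : ‖M‖ ^ 2 = ∑ i, ∑ j, ‖M i j‖ ^ 2 := by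
  rw [Matrix.frobenius_norm_def, ← Real.sqrt_eq_rpow, Real.sq_sqrt (by positivity)]
  simp

lemma frobenius_sq_eq_sum_rows (M : Matrix m n ℂ) :
    ‖M‖ ^ 2 = ∑ i, ‖WithLp.toLp 2 (M i)‖ ^ 2 := by
  simp [frobenius_sq, EuclideanSpace.norm_sq_eq]

lemma frobenius_sq_eq_trace (M : Matrix m n ℂ) :
    ((‖M‖ ^ 2 : ℝ) : ℂ) = (M * Mᴴ).trace := by
  simp [frobenius_sq, Matrix.trace, Matrix.mul_apply, Complex.mul_conj,
    Complex.normSq_eq_norm_sq]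

lemma frobenius_pythagoras {A B : Matrix m n ℂ} (h : A * Bᴴ = 0) :
    ‖A + B‖ ^ 2 = ‖A‖ ^ 2 + ‖B‖ ^ 2 := by
  have h' : B * Aᴴ = 0 := by simpa using congrArg Matrix.conjTranspose h
  apply Complex.ofReal_injective
  rw [Complex.ofReal_add, frobenius_sq_eq_trace, frobenius_sq_eq_trace, frobenius_sq_eq_trace,
    Matrix.conjTranspose_add, Matrix.add_mul, Matrix.mul_add, Matrix.mul_add, h, h',
    ← Matrix.trace_add, add_zero, zero_add]

lemma frobenius_pythagoras' {A B : Matrix m n ℂ} (h : Aᴴ * B = 0) :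
    ‖A + B‖ ^ 2 = ‖A‖ ^ 2 + ‖B‖ ^ 2 := by
  have := frobenius_pythagoras (A := Aᴴ) (B := Bᴴ) (by simpa using h)
  rwa [← Matrix.conjTranspose_add, Matrix.frobenius_norm_conjTranspose,
    Matrix.frobenius_norm_conjTranspose, Matrix.frobenius_norm_conjTranspose] at this

lemma frobenius_mul_of_coisometry [DecidableEq m] (Z : Matrix l m ℂ) {Q : Matrix m n ℂ} {a : ℝ}
    (ha : 0 ≤ a) (hQ : Q * Qᴴ = (a : ℂ) • (1 : Matrix m m ℂ)) : ‖Z * Q‖ = √a * ‖Z‖ := by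
  have h : ‖Z * Q‖ ^ 2 = (√a * ‖Z‖) ^ 2 := by
    apply Complex.ofReal_injective
    rw [mul_pow, Real.sq_sqrt ha, Complex.ofReal_mul, frobenius_sq_eq_trace,
      frobenius_sq_eq_trace, Matrix.conjTranspose_mul, ← Matrix.mul_assoc, Matrix.mul_assoc Z, hQ]
    simp
  exact (sq_eq_sq₀ (norm_nonneg _) (by positivity)).1 h

lemma norm_vecMul_of_coisometry [DecidableEq m] (x : m → ℂ) {Q : Matrix m n ℂ} {a : ℝ}
    (ha : 0 ≤ a) (hQ : Q * Qᴴ = (a : ℂ) • (1 : Matrix m m ℂ)) :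
    ‖WithLp.toLp 2 (x ᵥ* Q)‖ = √a * ‖WithLp.toLp 2 x‖ := by
  rw [← Matrix.frobenius_norm_replicateRow (ι := Unit), Matrix.replicateRow_vecMul,
    frobenius_mul_of_coisometry _ ha hQ, Matrix.frobenius_norm_replicateRow]

lemma norm_vecMul_le (x : m → ℂ) (Q : Matrix m n ℂ) :
    ‖WithLp.toLp 2 (x ᵥ* Q)‖ ≤ ‖WithLp.toLp 2 x‖ * ‖Q‖ := by
  rw [← Matrix.frobenius_norm_replicateRow (ι := Unit), Matrix.replicateRow_vecMul,
    ← Matrix.frobenius_norm_replicateRow (ι := Unit) x]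
  exact Matrix.frobenius_norm_mul _ _

lemma frobenius_vecMulVec (x : m → ℂ) (y : n → ℂ) :
    ‖Matrix.vecMulVec x y‖ = ‖WithLp.toLp 2 x‖ * ‖WithLp.toLp 2 y‖ := by
  rw [← sq_eq_sq₀ (norm_nonneg _) (by positivity), mul_pow, frobenius_sq,
    EuclideanSpace.norm_sq_eq, EuclideanSpace.norm_sq_eq, Finset.sum_mul_sum]
  simp [Matrix.vecMulVec_apply, mul_pow]

/-- A matrix at Frobenius distance at most `1/2` from the identity is invertible. -/
lemma isUnit_det_of_norm_sub_one_le [DecidableEq m] {G : Matrix m m ℂ} (h : ‖G - 1‖ ≤ 1 / 2) :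
    IsUnit G.det := by
  rw [isUnit_iff_ne_zero]
  intro h0
  obtain ⟨v, hv, hGv⟩ := Matrix.exists_vecMul_eq_zero_iff.2 h0
  have h1 := norm_vecMul_le v (G - 1)
  rw [Matrix.vecMul_sub, hGv, Matrix.vecMul_one, zero_sub, WithLp.toLp_neg, norm_neg] at h1
  have h2 : 0 < ‖WithLp.toLp 2 v‖ := by simpa using hv
  nlinarith

/-- Since `Z G⁻¹ = Z - Z G⁻¹ (G - 1)`, the last term costs at most half of the left side and is
absorbed. -/
lemma norm_mul_inv_le [DecidableEq m] {G : Matrix m m ℂ} (h : ‖G - 1‖ ≤ 1 / 2)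
    (Z : Matrix l m ℂ) : ‖Z * G⁻¹‖ ≤ 2 * ‖Z‖ := by
  have hdet := isUnit_det_of_norm_sub_one_le h
  have e : Z * G⁻¹ = Z - Z * G⁻¹ * (G - 1) := by
    rw [Matrix.mul_sub, Matrix.nonsing_inv_mul_cancel_right _ _ hdet, Matrix.mul_one, sub_sub_cancel]
  have h1 : ‖Z * G⁻¹‖ ≤ ‖Z‖ + ‖Z * G⁻¹‖ * (1 / 2) := by
    calc ‖Z * G⁻¹‖ = ‖Z - Z * G⁻¹ * (G - 1)‖ := by rw [← e]
      _ ≤ ‖Z‖ + ‖Z * G⁻¹ * (G - 1)‖ := norm_sub_le _ _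
      _ ≤ ‖Z‖ + ‖Z * G⁻¹‖ * ‖G - 1‖ := by gcongr; exact Matrix.frobenius_norm_mul _ _
      _ ≤ _ := by gcongr
  linarith

end Frobenius

/-! ### The Moore–Penrose inverse -/

/-- Diagonalize and invert the eigenvalues; the convention `0⁻¹ = 0` is exactly what the
pseudoinverse needs. -/
lemma exists_isMoorePenrose_of_isHermitian {n : ℕ} {G : Matrix (Fin n) (Fin n) ℂ}
    (hG : G.IsHermitian) :
    ∃ X : Matrix (Fin n) (Fin n) ℂ, IsMoorePenrose G X ∧ X.IsHermitian := by
  obtain ⟨U, d, hU, rfl⟩ : ∃ (U : Matrix (Fin n) (Fin n) ℂ) (d : Fin n → ℝ), Uᴴ * U = 1 ∧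
      G = U * Matrix.diagonal (fun i => (d i : ℂ)) * Uᴴ := by
    refine ⟨hG.eigenvectorUnitary, hG.eigenvalues, Unitary.coe_star_mul_self _, ?_⟩
    have := hG.spectral_theorem
    rw [Unitary.conjStarAlgAut_apply] at this
    exact this
  have hmul : ∀ a b : Fin n → ℂ, U * Matrix.diagonal a * Uᴴ * (U * Matrix.diagonal b * Uᴴ) =
      U * Matrix.diagonal (fun i => a i * b i) * Uᴴ := by
    intro a b
    calc _ = U * Matrix.diagonal a * (Uᴴ * U) * Matrix.diagonal b * Uᴴ := by
          simp only [Matrix.mul_assoc]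
      _ = _ := by
          rw [hU, Matrix.mul_one, Matrix.mul_assoc U, Matrix.diagonal_mul_diagonal]
  have hherm : ∀ a : Fin n → ℝ,
      (U * Matrix.diagonal (fun i => (a i : ℂ)) * Uᴴ).IsHermitian := by
    intro a
    apply Matrix.isHermitian_mul_mul_conjTranspose
    rw [Matrix.isHermitian_diagonal_iff]
    intro i
    simp [isSelfAdjoint_iff]
  have hcast : ∀ a b : Fin n → ℝ, (fun i => (a i : ℂ) * (b i : ℂ)) =
      fun i => ((a i * b i : ℝ) : ℂ) := by
    intro a b
    funext i
    push_cast
    rfl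
  refine ⟨U * Matrix.diagonal (fun i => ((d i)⁻¹ : ℝ) : Fin n → ℂ) * Uᴴ,
    ⟨?_, ?_, ?_, ?_⟩, hherm _⟩
  · rw [hmul, hmul]
    congr 3
    funext i
    by_cases h : d i = 0 <;> simp [h]
  · rw [hmul, hmul]
    congr 3
    funext i
    by_cases h : d i = 0 <;> simp [h]
  · rw [hmul, hcast]
    exact hherm _
  · rw [hmul, hcast]
    exact hherm _

open scoped ComplexOrder in
lemma exists_isMoorePenrose {m n : ℕ} (M : Matrix (Fin m) (Fin n) ℂ) :
    ∃ X, IsMoorePenrose M X := by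
  obtain ⟨X, hX, hXh⟩ :=
    exists_isMoorePenrose_of_isHermitian (Matrix.isHermitian_conjTranspose_mul_self M)
  -- The formula `M† = (Mᴴ M)† Mᴴ`. For the first identity, the defect `E` has the form `M Q` and
  -- satisfies `Mᴴ E = 0`, so `Eᴴ E = 0`.
  refine ⟨X * Mᴴ, ?_, ?_, ?_, ?_⟩
  · rw [← sub_eq_zero]
    apply Matrix.conjTranspose_mul_self_eq_zero.1
    have e : M * (X * Mᴴ) * M - M = M * (X * (Mᴴ * M) - 1) := by
      simp only [Matrix.mul_sub, Matrix.mul_one, Matrix.mul_assoc]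
    have h0 : Mᴴ * (M * (X * (Mᴴ * M) - 1)) = 0 := by
      have := hX.mul_mul_left
      simp only [Matrix.mul_sub, Matrix.mul_one, Matrix.mul_assoc] at this ⊢
      rw [this, sub_self]
    rw [e, Matrix.conjTranspose_mul, Matrix.mul_assoc, h0, Matrix.mul_zero]
  · have := hX.mul_mul_right
    rw [Matrix.mul_assoc X Mᴴ M, ← Matrix.mul_assoc, this]
  · rw [← Matrix.mul_assoc]
    exact Matrix.isHermitian_mul_mul_conjTranspose M hXh
  · rw [Matrix.mul_assoc]
    exact hX.isHermitian_right

/-- `M M†` is the best approximation by matrices with columns in the range of `M`. -/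
lemma IsMoorePenrose.norm_sub_le {m n p : ℕ} {M : Matrix (Fin m) (Fin n) ℂ}
    {X : Matrix (Fin n) (Fin m) ℂ} (h : IsMoorePenrose M X)
    (A : Matrix (Fin m) (Fin p) ℂ) (Z : Matrix (Fin n) (Fin p) ℂ) :
    ‖A - M * X * A‖ ≤ ‖A - M * Z‖ := by
  -- The residual is orthogonal to the range of `M`, so Pythagoras applies against any competitor `M
  -- Z`.
  have h0 : (A - M * X * A)ᴴ * M = 0 := by
    have e : (M * X)ᴴ = M * X := h.isHermitian_left
    rw [Matrix.conjTranspose_sub, Matrix.conjTranspose_mul (M * X), e, Matrix.sub_mul,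
      Matrix.mul_assoc Aᴴ, h.mul_mul_left, sub_self]
  have hp := frobenius_pythagoras' (A := A - M * X * A) (B := M * (X * A - Z))
    (by rw [← Matrix.mul_assoc, h0, Matrix.zero_mul])
  have e : A - M * X * A + M * (X * A - Z) = A - M * Z := by
    rw [Matrix.mul_sub, Matrix.mul_assoc]
    abel
  rw [e] at hp
  apply (sq_le_sq₀ (norm_nonneg _) (norm_nonneg _)).1
  nlinarith [sq_nonneg ‖M * (X * A - Z)‖]

/-! ### Sampled matrix products -/

lemma mul_maskMatrix_transpose_apply {m : Type*} {S T : ℕ} (A : Matrix m (Fin T) ℂ)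
    (I : Mask S T) (i : m) (s : Fin S) : (A * (maskMatrix I)ᵀ) i s = A i (I s) := by
  simp [Matrix.mul_apply, maskMatrix]

lemma maskMatrix_mul_apply {n : Type*} {S T : ℕ} (B : Matrix (Fin T) n ℂ)
    (I : Mask S T) (s : Fin S) (j : n) : (maskMatrix I * B) s j = B (I s) j := by
  simp [Matrix.mul_apply, maskMatrix]

/-- The estimator of `A * B` that uses only the columns of `A` and rows of `B` selected by `I`. -/
noncomputable def sampledMul {m n : Type*} {S T : ℕ} (A : Matrix m (Fin T) ℂ)
    (B : Matrix (Fin T) n ℂ) (I : Mask S T) : Matrix m n ℂ :=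
  ((T : ℂ) / S) • (A * (maskMatrix I)ᵀ * (maskMatrix I * B))

/-- Each entry of the product is a sum over `t`, so the scalar variance bound applies entrywise;
summing over `j` first leaves the squared row norms of `B`, which `κ` controls. -/
lemma sum_sq_sampledMul_sub_le {m n : Type*} [Fintype m] [Fintype n] {S T : ℕ}
    (hS : 0 < S) (hST : S ≤ T) (A : Matrix m (Fin T) ℂ) (B : Matrix (Fin T) n ℂ) {κ : ℝ}
    (hκ : ∀ t, ∑ j, ‖B t j‖ ^ 2 ≤ κ) :
    ∑ I : Mask S T, ‖sampledMul A B I - A * B‖ ^ 2 ≤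
      Fintype.card (Mask S T) * ((T : ℝ) / S * κ * ‖A‖ ^ 2) := by
  have hentry : ∀ (I : Mask S T) i j, (sampledMul A B I - A * B) i j =
      ((T : ℂ) / S) * ∑ s, A i (I s) * B (I s) j - ∑ t, A i t * B t j := by
    intro I i j
    rw [Matrix.sub_apply, sampledMul, Matrix.smul_apply, Matrix.mul_apply, Matrix.mul_apply]
    simp only [mul_maskMatrix_transpose_apply, maskMatrix_mul_apply, smul_eq_mul]
  simp_rw [frobenius_sq, hentry]
  rw [Finset.sum_comm]
  calc ∑ i, ∑ I : Mask S T, ∑ j,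
        ‖((T : ℂ) / S) * ∑ s, A i (I s) * B (I s) j - ∑ t, A i t * B t j‖ ^ 2
      ≤ ∑ i, ∑ j, Fintype.card (Mask S T) * ((T : ℝ) / S * ∑ t, ‖A i t * B t j‖ ^ 2) := by
        refine Finset.sum_le_sum fun i _ => ?_
        rw [Finset.sum_comm]
        exact Finset.sum_le_sum fun j _ =>
          Mask.sum_sq_estimator_le hS hST fun t => A i t * B t j
    _ = Fintype.card (Mask S T) * ((T : ℝ) / S *
          ∑ i, ∑ t, ‖A i t‖ ^ 2 * ∑ j, ‖B t j‖ ^ 2) := by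
        simp_rw [← Finset.mul_sum, norm_mul, mul_pow]
        congr 2
        refine Finset.sum_congr rfl fun i _ => ?_
        rw [Finset.sum_comm]
        simp_rw [Finset.mul_sum]
    _ ≤ Fintype.card (Mask S T) * ((T : ℝ) / S * ∑ i, ∑ t, ‖A i t‖ ^ 2 * κ) := by
        gcongr with i _ t _
        exact hκ t
    _ = _ := by
        simp_rw [← Finset.sum_mul]
        ring

/-! ### Column subset selection -/

namespace SVD

variable {N T : ℕ} {A : Matrix (Fin N) (Fin T) ℂ} (s : SVD A) (k : ℕ)

/-- The matrix of the top `k` right singular vectors. -/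
def topV : Matrix (Fin T) {i : Fin (min N T) // i.val < k} ℂ :=
  s.V.submatrix id Subtype.val

/-- The matrix of the top `k` left singular vectors, scaled by the singular values. -/
noncomputable def topUσ : Matrix (Fin N) {i : Fin (min N T) // i.val < k} ℂ :=
  Matrix.of fun n i => s.U n i.val * s.σ i.val

lemma topV_orthonormal : (s.topV k)ᴴ * s.topV k = 1 := by
  have h := congrArg (fun M => M.submatrix (Subtype.val : {i : Fin (min N T) // i.val < k} → _)
    (Subtype.val : {i : Fin (min N T) // i.val < k} → _)) s.V_orthonormal
  simp only [Matrix.submatrix_one _ Subtype.val_injective] at h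
  rw [← h]
  ext i j
  simp [topV, Matrix.mul_apply]

lemma truncate_eq : s.truncate k = s.topUσ k * (s.topV k)ᴴ := by
  ext n t
  rw [truncate, Matrix.mul_apply, Matrix.mul_apply]
  simp only [Matrix.mul_diagonal, mul_ite, mul_zero, ite_mul, zero_mul]
  rw [← Finset.sum_filter, Finset.sum_subtype (p := fun i : Fin (min N T) => i.val < k) _ (by simp)]
  rfl

lemma mul_topV : A * s.topV k = s.topUσ k := by
  have h : A * s.V = s.U * Matrix.diagonal (fun i => (s.σ i : ℂ)) := by
    calc A * s.V = s.U * Matrix.diagonal (fun i => (s.σ i : ℂ)) * s.Vᴴ * s.V :=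
          congrArg (· * s.V) s.eq_mul
      _ = _ := by rw [Matrix.mul_assoc, s.V_orthonormal, Matrix.mul_one]
  ext n i
  have := congrFun (congrFun h n) i.val
  rw [Matrix.mul_diagonal] at this
  exact this

lemma sub_truncate_mul_topV : (A - s.truncate k) * s.topV k = 0 := by
  rw [Matrix.sub_mul, mul_topV, truncate_eq, Matrix.mul_assoc, topV_orthonormal, Matrix.mul_one,
    sub_self]

lemma sum_topV_sq_le_coherence (t : Fin T) :
    ∑ i, ‖s.topV k t i‖ ^ 2 ≤ s.coherence k := by
  refine le_trans (le_of_eq ?_) (le_ciSup (Set.finite_range _).bddAbove t)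
  rw [Finset.sum_subtype (p := fun i : Fin (min N T) => i.val < k) _ (by simp)]
  rfl

/-- Only an inequality, since `k` may exceed `min N T`. -/
lemma frobenius_topV_sq_le : ‖(s.topV k)ᴴ‖ ^ 2 ≤ k := by
  have h : ((‖(s.topV k)ᴴ‖ ^ 2 : ℝ) : ℂ) =
      (Fintype.card {i : Fin (min N T) // i.val < k} : ℝ) := by
    rw [frobenius_sq_eq_trace, Matrix.conjTranspose_conjTranspose, topV_orthonormal,
      Matrix.trace_one]
    simp
  rw [Complex.ofReal_injective h]
  have hinj : Function.Injective
      (fun i : {i : Fin (min N T) // i.val < k} => (⟨i.val.val, i.2⟩ : Fin k)) := by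
    intro i j hij
    exact Subtype.ext (Fin.ext (Fin.mk.inj hij))
  exact_mod_cast (Fintype.card_le_of_injective _ hinj).trans_eq (Fintype.card_fin k)

/-- Projecting on selected columns is nearly as good as the best rank-`k` approximation if the
selection nearly preserves two products with the top right singular vectors. -/
lemma norm_sub_le_of_sampledMul {S : ℕ} {I : Mask S T} {ε : ℝ}
    (h1 : ‖sampledMul (s.topV k)ᴴ (s.topV k) I - 1‖ ≤ 1 / 2)
    (h2 : ‖sampledMul (A - s.truncate k) (s.topV k) I‖ ≤ ε / 2 * ‖A - s.truncate k‖)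
    {X : Matrix (Fin S) (Fin N) ℂ} (hX : IsMoorePenrose (sampleColumns A I) X) :
    ‖A - sampleColumns A I * X * A‖ ≤ (1 + ε) * ‖A - s.truncate k‖ := by
  set R := A - s.truncate k with hR
  set v := s.topV k with hv
  set G := sampledMul vᴴ v I with hG
  set Z := ((T : ℂ) / S) • (maskMatrix I * v * G⁻¹ * vᴴ) with hZ
  -- `Z` is chosen so that sampling `B` and multiplying by `Z` gives the estimator of `B v`,
  -- corrected by `G⁻¹`. For `B = vᴴ` the correction is exact, so `A_k` is reproduced; for `B = R`
  -- only a small perturbation remains.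
  have hsample : ∀ {m : Type} (B : Matrix m (Fin T) ℂ),
      B * (maskMatrix I)ᵀ * Z = sampledMul B v I * G⁻¹ * vᴴ := by
    intro m B
    simp only [hZ, sampledMul, Matrix.mul_smul, Matrix.smul_mul, Matrix.mul_assoc]
  have hG1 : G * G⁻¹ = 1 := Matrix.mul_nonsing_inv _ (isUnit_det_of_norm_sub_one_le h1)
  have htr : s.truncate k * (maskMatrix I)ᵀ * Z = s.truncate k := by
    rw [truncate_eq, ← hv, Matrix.mul_assoc, Matrix.mul_assoc, ← Matrix.mul_assoc vᴴ, hsample,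
      ← hG, hG1, Matrix.one_mul]
  have hAZ : A - sampleColumns A I * Z = R + -(sampledMul R v I * G⁻¹ * vᴴ) := by
    have hA : A = s.truncate k + R := by rw [hR]; abel
    have : sampleColumns A I * Z = s.truncate k + sampledMul R v I * G⁻¹ * vᴴ := by
      rw [sampleColumns, ← hsample R]
      conv_lhs => rw [hA]
      rw [Matrix.add_mul, Matrix.add_mul, htr]
    rw [this, hR]
    abel
  have hRv : R * v = 0 := s.sub_truncate_mul_topV k
  have horth : R * (-(sampledMul R v I * G⁻¹ * vᴴ))ᴴ = 0 := by
    rw [Matrix.conjTranspose_neg, Matrix.conjTranspose_mul, Matrix.conjTranspose_conjTranspose,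
      Matrix.mul_neg, ← Matrix.mul_assoc, hRv, Matrix.zero_mul, neg_zero]
  have hiso : ‖sampledMul R v I * G⁻¹ * vᴴ‖ = ‖sampledMul R v I * G⁻¹‖ := by
    rw [frobenius_mul_of_coisometry (a := 1) _ zero_le_one, Real.sqrt_one, one_mul]
    rw [Matrix.conjTranspose_conjTranspose, s.topV_orthonormal k, Complex.ofReal_one, one_smul]
  have hpert : ‖sampledMul R v I * G⁻¹ * vᴴ‖ ≤ ε * ‖R‖ := by
    rw [hiso]
    linarith [norm_mul_inv_le h1 (sampledMul R v I)]
  refine (hX.norm_sub_le A Z).trans ?_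
  rw [hAZ]
  refine (norm_add_le _ _).trans ?_
  rw [norm_neg]
  linarith

end SVD

/-- Markov's inequality in counting form. -/
lemma card_mul_le_sum {Ω : Type*} [Fintype Ω] {f : Ω → ℝ} (hf : ∀ x, 0 ≤ f x)
    (a : ℝ) [DecidablePred fun x => a < f x] :
    ((Finset.univ.filter fun x => a < f x).card : ℝ) * a ≤ ∑ x, f x := by
  calc _ = ∑ x with a < f x, a := by simp
    _ ≤ ∑ x with a < f x, f x := Finset.sum_le_sum fun x hx => (Finset.mem_filter.1 hx).2.le
    _ ≤ _ := Finset.sum_le_sum_of_subset_of_nonneg (Finset.filter_subset _ _) fun x _ _ => hf x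

/-- Uniform column sampling from an incoherent matrix gives, with probability at least `1 - δ`, a
relative-error rank-`k` approximation. -/
theorem SVD.uniformProb_columnSelection {c δ : ℝ} (hc : 0 < c) (hδ : 0 < δ) {N T k S : ℕ} {ε : ℝ}
    {A : Matrix (Fin N) (Fin T) ℂ} (s : SVD A) (hε : 0 < ε) (hε1 : ε ≤ 1)
    (hcoh : s.coherence k ≤ c * k / T) (hST : S ≤ T)
    (hS : 8 * c / δ * (k : ℝ) ^ 2 / ε ^ 2 ≤ S) :
    1 - δ ≤ uniformProb {I : Mask S T | ∀ X, IsMoorePenrose (sampleColumns A I) X →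
      ‖A - sampleColumns A I * X * A‖ ≤ (1 + ε) * ‖A - s.truncate k‖} := by
  classical
  set E : Set (Mask S T) := {I : Mask S T | ∀ X, IsMoorePenrose (sampleColumns A I) X →
      ‖A - sampleColumns A I * X * A‖ ≤ (1 + ε) * ‖A - s.truncate k‖} with hE
  have hcard : 0 < Fintype.card (Mask S T) := by
    rw [Mask.card_eq_choose]
    exact Nat.choose_pos hST
  have hM : (0 : ℝ) < (Fintype.card (Mask S T) : ℕ) := by exact_mod_cast hcard
  suffices h : ((Finset.univ.filter fun I => I ∉ E).card : ℝ) ≤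
      δ * (Fintype.card (Mask S T) : ℕ) by
    rw [uniformProb, Nat.card_eq_fintype_card, Nat.card_eq_fintype_card, le_div_iff₀ hM,
      Fintype.card_subtype]
    have h3 : ((Finset.univ.filter fun I => I ∈ E).card : ℝ) +
        (Finset.univ.filter fun I => I ∉ E).card = (Fintype.card (Mask S T) : ℕ) := by
      exact_mod_cast Finset.card_filter_add_card_filter_not (s := Finset.univ) (fun I => I ∈ E)
    linarith
  -- For `k = 0` even `S = 0` is allowed, but the truncation vanishes and the zero competitor
  -- suffices for every selection.
  rcases Nat.eq_zero_or_pos k with hk | hk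
  · have : ∀ I, I ∈ E := by
      intro I X hX
      have h0 : s.truncate k = 0 := by
        have : IsEmpty {i : Fin (min N T) // i.val < k} := ⟨fun i => by
          have := i.2
          omega⟩
        rw [s.truncate_eq]
        ext i j
        simp [Matrix.mul_apply]
      have h1 := hX.norm_sub_le A 0
      rw [Matrix.mul_zero, sub_zero] at h1
      rw [h0, sub_zero]
      nlinarith [norm_nonneg A]
    simp only [this, not_true_eq_false, Finset.filter_false, Finset.card_empty, Nat.cast_zero]
    positivity
  have hk1 : (1 : ℝ) ≤ k := by exact_mod_cast hk
  have hSpos : (0 : ℝ) < S := lt_of_lt_of_le (by positivity) hS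
  have hSnat : 0 < S := by exact_mod_cast hSpos
  have hTpos : (0 : ℝ) < T := by exact_mod_cast hSnat.trans_le hST
  set R := A - s.truncate k
  set v := s.topV k
  have hκ : ∀ t, ∑ j, ‖v t j‖ ^ 2 ≤ c * k / T := fun t =>
    (s.sum_topV_sq_le_coherence k t).trans hcoh
  have hr : (T : ℝ) / S * (c * k / T) = c * k / S := by field_simp
  -- The `8` is `4 * 2`: both Markov thresholds carry a factor `1 / 4`, and each of the two bad
  -- events may use `δ / 2`. Only the first event needs `k ^ 2`, one factor being `‖v‖ ^ 2 ≤ k`.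
  have hSk : c * (k : ℝ) ^ 2 / S ≤ ε ^ 2 * δ / 8 := by
    rw [div_le_iff₀ (by positivity)] at hS ⊢
    rw [div_mul_eq_mul_div, div_le_iff₀ hδ] at hS
    linarith
  have hmom1 := sum_sq_sampledMul_sub_le hSnat hST vᴴ v hκ
  have hmom2 := sum_sq_sampledMul_sub_le hSnat hST R v hκ
  rw [s.topV_orthonormal k, hr] at hmom1
  rw [show R * v = 0 from s.sub_truncate_mul_topV k, hr] at hmom2
  simp only [sub_zero] at hmom2
  have hbad1 := (card_mul_le_sum (fun I : Mask S T => sq_nonneg ‖sampledMul vᴴ v I - 1‖)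
    (1 / 4)).trans hmom1
  have hbad2 := (card_mul_le_sum (fun I : Mask S T => sq_nonneg ‖sampledMul R v I‖)
    (ε ^ 2 / 4 * ‖R‖ ^ 2)).trans hmom2
  have hcount1 : ((Finset.univ.filter fun I : Mask S T =>
      1 / 4 < ‖sampledMul vᴴ v I - 1‖ ^ 2).card : ℝ) ≤ δ / 2 * (Fintype.card (Mask S T) : ℕ) := by
    have h1 : c * k / S * ‖vᴴ‖ ^ 2 ≤ δ / 8 := by
      calc c * k / S * ‖vᴴ‖ ^ 2 ≤ c * k / S * k := by
            gcongr
            exact s.frobenius_topV_sq_le k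
        _ = c * (k : ℝ) ^ 2 / S := by ring
        _ ≤ ε ^ 2 * δ / 8 := hSk
        _ ≤ 1 ^ 2 * δ / 8 := by gcongr
        _ = δ / 8 := by ring
    have := mul_le_mul_of_nonneg_left h1 hM.le
    linarith
  have hcount2 : ((Finset.univ.filter fun I : Mask S T =>
      ε ^ 2 / 4 * ‖R‖ ^ 2 < ‖sampledMul R v I‖ ^ 2).card : ℝ) ≤
      δ / 2 * (Fintype.card (Mask S T) : ℕ) := by
    -- At `R = 0` the Markov threshold is `0` and gives nothing, but then the estimator itself
    -- vanishes.
    rcases eq_or_lt_of_le (sq_nonneg ‖R‖) with h0 | hpos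
    · have hR0 : R = 0 := by simpa using h0.symm
      rw [Finset.filter_eq_empty_iff.2 fun I _ => by simp [sampledMul, hR0], Finset.card_empty,
        Nat.cast_zero]
      positivity
    · have h1 : c * k / S ≤ ε ^ 2 * δ / 8 := by
        refine le_trans ?_ hSk
        gcongr
        nlinarith
      have h2 := mul_le_mul_of_nonneg_left
        (mul_le_mul_of_nonneg_right h1 hpos.le) hM.le
      have h3 : 0 < ε ^ 2 / 4 * ‖R‖ ^ 2 := by positivity
      refine le_of_mul_le_mul_right ?_ h3
      linarith
  have hsub : (Finset.univ.filter fun I => I ∉ E) ⊆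
      (Finset.univ.filter fun I : Mask S T => 1 / 4 < ‖sampledMul vᴴ v I - 1‖ ^ 2) ∪
      (Finset.univ.filter fun I : Mask S T =>
        ε ^ 2 / 4 * ‖R‖ ^ 2 < ‖sampledMul R v I‖ ^ 2) := by
    intro I hI
    simp only [Finset.mem_union, Finset.mem_filter, Finset.mem_univ, true_and] at hI ⊢
    by_contra! hcon
    refine hI fun X hX => s.norm_sub_le_of_sampledMul k ?_ ?_ hX
    · refine (sq_le_sq₀ (norm_nonneg _) (by norm_num)).1 (hcon.1.trans_eq (by norm_num))
    · refine (sq_le_sq₀ (norm_nonneg _) (by positivity)).1 (hcon.2.trans_eq (by ring))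
  have h1 := (Finset.card_le_card hsub).trans (Finset.card_union_le _ _)
  have h2 : ((Finset.univ.filter fun I => I ∉ E).card : ℝ) ≤
      (Finset.univ.filter fun I : Mask S T => 1 / 4 < ‖sampledMul vᴴ v I - 1‖ ^ 2).card +
      (Finset.univ.filter fun I : Mask S T =>
        ε ^ 2 / 4 * ‖R‖ ^ 2 < ‖sampledMul R v I‖ ^ 2).card := by
    exact_mod_cast h1
  linarith

/-! ### Frequency-domain models -/

namespace OrthogonalProjector

variable {T : ℕ} (F : OrthogonalProjector T)

lemma isUnit_det : IsUnit F.mat.det := by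
  have h : F.mat * ((F.scale : ℂ)⁻¹ • F.matᴴ) = 1 := by
    rw [Matrix.mul_smul, F.orthogonal, smul_smul, inv_mul_cancel₀, one_smul]
    exact_mod_cast F.scale_pos.ne'
  exact Matrix.isUnit_det_of_right_inverse h

lemma inv_mul_conjTranspose :
    F.mat⁻¹ * F.mat⁻¹ᴴ = ((F.scale⁻¹ : ℝ) : ℂ) • (1 : Matrix (Fin T) (Fin T) ℂ) := by
  have h : F.mat * ((F.scale : ℂ)⁻¹ • F.matᴴ) = 1 := by
    rw [Matrix.mul_smul, F.orthogonal, smul_smul, inv_mul_cancel₀, one_smul]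
    exact_mod_cast F.scale_pos.ne'
  have h' : F.mat⁻¹ = (F.scale : ℂ)⁻¹ • F.matᴴ := Matrix.inv_eq_right_inv h
  have h2 : F.mat⁻¹ * F.mat = 1 := Matrix.nonsing_inv_mul _ F.isUnit_det
  have h3 : F.mat⁻¹ᴴ = (F.scale : ℂ)⁻¹ • F.mat := by
    rw [h', Matrix.conjTranspose_smul, Matrix.conjTranspose_conjTranspose]
    simp
  rw [h3, Matrix.mul_smul, h2, Complex.ofReal_inv]

lemma norm_inverse {N : ℕ} (Z : Matrix (Fin N) (Fin T) ℂ) :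
    ‖F.inverse Z‖ = ‖Z‖ / √F.scale := by
  rw [inverse, frobenius_mul_of_coisometry Z (inv_nonneg.2 F.scale_pos.le)
    F.inv_mul_conjTranspose, Real.sqrt_inv, div_eq_inv_mul]

lemma norm_spectral_row {N : ℕ} (H : Matrix (Fin N) (Fin T) ℝ) (n : Fin N) :
    ‖WithLp.toLp 2 (F.spectral H n)‖ = √F.scale * ‖WithLp.toLp 2 (H n)‖ := by
  have h : F.spectral H n = (H.map Complex.ofReal n) ᵥ* F.mat := rfl
  rw [h, norm_vecMul_of_coisometry _ F.scale_pos.le F.orthogonal]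
  simp [EuclideanSpace.norm_eq]

end OrthogonalProjector

/-- The rows are filtered separately, and the Frobenius norm of each filter dominates its operator
norm, so no factor depending on `N` appears. -/
lemma norm_applyFilters_le {N R T : ℕ} (A : Matrix (Fin N) (Fin R) ℂ)
    (W : Fin N → Matrix (Fin R) (Fin T) ℂ) {B : ℝ} (hB : 0 ≤ B) (hW : ∀ n, ‖W n‖ ≤ B) :
    ‖applyFilters A W‖ ≤ B * ‖A‖ := by
  apply (sq_le_sq₀ (norm_nonneg _) (by positivity)).1
  rw [mul_pow, frobenius_sq_eq_sum_rows, frobenius_sq_eq_sum_rows A, Finset.mul_sum]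
  refine Finset.sum_le_sum fun n _ => ?_
  rw [← mul_pow]
  refine pow_le_pow_left₀ (norm_nonneg _) ?_ 2
  refine (norm_vecMul_le (A n) (W n)).trans ?_
  rw [mul_comm]
  exact mul_le_mul_of_nonneg_right (hW n) (norm_nonneg _)

/-- By associativity, row `n` of `A'` times `X A W n` is row `n` of `A' X A` times `W n`, so the
individual filters factor through one common residual. -/
lemma fullFDM_sub_reducedFDM {N S T : ℕ} (F : OrthogonalProjector T)
    (H : Matrix (Fin N) (Fin T) ℝ) (I : Mask S T) (X : Matrix (Fin S) (Fin N) ℂ)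
    (W : Fin N → Matrix (Fin T) (Fin T) ℂ) :
    fullFDM F H W - reducedFDM F H I (fun n => X * F.spectral H * W n) =
      F.inverse (applyFilters
        (F.spectral H - sampleColumns (F.spectral H) I * X * F.spectral H) W) := by
  rw [fullFDM, reducedFDM, OrthogonalProjector.inverse, OrthogonalProjector.inverse,
    OrthogonalProjector.inverse, ← Matrix.sub_mul]
  congr 1
  refine funext fun n => ?_
  change F.spectral H n ᵥ* W n - sampleColumns (F.spectral H) I n ᵥ* (X * F.spectral H * W n) =
    (F.spectral H - sampleColumns (F.spectral H) I * X * F.spectral H) n ᵥ* W n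
  have h : (F.spectral H - sampleColumns (F.spectral H) I * X * F.spectral H) n =
      F.spectral H n - sampleColumns (F.spectral H) I n ᵥ* (X * F.spectral H) := by
    rw [Matrix.mul_assoc]
    rfl
  rw [h, Matrix.sub_vecMul, Matrix.vecMul_vecMul]

/-- Bounded full-order individual filters produce every target that is bounded row by row. -/
lemma exists_fullFDM_eq {N T : ℕ} (F : OrthogonalProjector T) (H : Matrix (Fin N) (Fin T) ℝ)
    (Y : Matrix (Fin N) (Fin T) ℂ) {B : ℝ} (hB : 0 ≤ B)
    (hY : ∀ n, ‖WithLp.toLp 2 (Y n)‖ ≤ B * ‖WithLp.toLp 2 (H n)‖) :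
    ∃ W : Fin N → Matrix (Fin T) (Fin T) ℂ, (∀ n, ‖W n‖ ≤ B) ∧ fullFDM F H W = Y := by
  set A := F.spectral H
  have hYF : ∀ n, ‖WithLp.toLp 2 ((Y * F.mat) n)‖ ≤ B * ‖WithLp.toLp 2 (A n)‖ := by
    intro n
    have h : (Y * F.mat) n = Y n ᵥ* F.mat := rfl
    rw [h, norm_vecMul_of_coisometry _ F.scale_pos.le F.orthogonal, F.norm_spectral_row]
    calc _ ≤ √F.scale * (B * ‖WithLp.toLp 2 (H n)‖) := by gcongr; exact hY n
      _ = _ := by ring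
  have hdot : ∀ n, A n ⬝ᵥ star (A n) = ((‖WithLp.toLp 2 (A n)‖ ^ 2 : ℝ) : ℂ) := by
    intro n
    simp [dotProduct, EuclideanSpace.norm_sq_eq, Complex.mul_conj, Complex.normSq_eq_norm_sq]
  -- The rank-one filter sending `A n` to row `n` of `Y F`, with Frobenius norm equal to the ratio
  -- of the two row norms. If `A n = 0`, the filter is zero and the row bound forces the target row
  -- to vanish.
  refine ⟨fun n => Matrix.vecMulVec (star (A n))
    ((((‖WithLp.toLp 2 (A n)‖ ^ 2)⁻¹ : ℝ) : ℂ) • (Y * F.mat) n), ?_, ?_⟩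
  · intro n
    have hstar : ‖WithLp.toLp 2 (star (A n))‖ = ‖WithLp.toLp 2 (A n)‖ := by
      simp [EuclideanSpace.norm_eq]
    rw [frobenius_vecMulVec, hstar, WithLp.toLp_smul, norm_smul, Complex.norm_real, norm_inv,
      norm_pow, norm_norm]
    rcases eq_or_lt_of_le (norm_nonneg (WithLp.toLp 2 (A n))) with h0 | hpos
    · rw [← h0]
      simpa using hB
    · calc ‖WithLp.toLp 2 (A n)‖ *
            ((‖WithLp.toLp 2 (A n)‖ ^ 2)⁻¹ * ‖WithLp.toLp 2 ((Y * F.mat) n)‖)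
          ≤ ‖WithLp.toLp 2 (A n)‖ *
            ((‖WithLp.toLp 2 (A n)‖ ^ 2)⁻¹ * (B * ‖WithLp.toLp 2 (A n)‖)) := by
            gcongr
            exact hYF n
        _ = B := by field_simp
  · have h : applyFilters A (fun n => Matrix.vecMulVec (star (A n))
        ((((‖WithLp.toLp 2 (A n)‖ ^ 2)⁻¹ : ℝ) : ℂ) • (Y * F.mat) n)) = Y * F.mat := by
      refine funext fun n => ?_
      change A n ᵥ* Matrix.vecMulVec _ _ = _
      rw [Matrix.vecMul_vecMulVec, hdot, smul_smul, ← Complex.ofReal_mul]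
      rcases eq_or_lt_of_le (norm_nonneg (WithLp.toLp 2 (A n))) with h0 | hpos
      · have hz : (Y * F.mat) n = 0 := by
          have := hYF n
          rw [← h0, mul_zero] at this
          simpa using this
        rw [hz, smul_zero]
      · rw [mul_inv_cancel₀ (by positivity), Complex.ofReal_one, one_smul]
    rw [fullFDM, h, OrthogonalProjector.inverse,
      Matrix.mul_nonsing_inv_cancel_right _ _ F.isUnit_det]

lemma DynGraph.expressive_of_norm_sub_le {N T D K S : ℕ} (G : DynGraph N T D)
    (P : Fin (K + 1) → Polynomial ℝ) (θ : Fin (K + 1) → ℝ) (F : OrthogonalProjector T)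
    (H : Matrix (Fin N) (Fin T) ℝ) (d : Fin D) (hH : G.nodeEmbedding P θ d = H) {η : ℝ}
    {I : Mask S T} (hI : ∀ X, IsMoorePenrose (sampleColumns (F.spectral H) I) X →
      ‖F.spectral H - sampleColumns (F.spectral H) I * X * F.spectral H‖ ≤ η) :
    G.Expressive P θ F H d (η / √F.scale) I := by
  obtain ⟨X, hX⟩ := exists_isMoorePenrose (sampleColumns (F.spectral H) I)
  have hbound : ∀ (W : Fin N → Matrix (Fin T) (Fin T) ℂ) (B : ℝ), 0 ≤ B → (∀ n, ‖W n‖ ≤ B) →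
      ‖fullFDM F H W - G.model P θ F d I (fun n => X * F.spectral H * W n)‖ ≤
        B * (η / √F.scale) := by
    intro W B hB hW
    rw [DynGraph.model, hH, fullFDM_sub_reducedFDM, F.norm_inverse, ← mul_div_assoc]
    gcongr
    exact (norm_applyFilters_le _ W hB hW).trans (mul_le_mul_of_nonneg_left (hI X hX) hB)
  refine ⟨X, hX, hbound, fun Y B hB hY => ?_⟩
  obtain ⟨W, hW, rfl⟩ := exists_fullFDM_eq F H Y hB hY
  exact ⟨W, hW, rfl, hbound W B hB hW⟩

/-! ### Uniform probabilities -/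

lemma uniformProb_mono {Ω : Type} [Finite Ω] {E E' : Set Ω} (h : E ⊆ E') :
    uniformProb E ≤ uniformProb E' := by
  rw [uniformProb, uniformProb]
  gcongr
  exact Nat.card_mono E'.toFinite h

lemma uniformProb_pi {ι Ω : Type} [Fintype ι] (E : ι → Set Ω) :
    uniformProb {f : ι → Ω | ∀ i, f i ∈ E i} = ∏ i, uniformProb (E i) := by
  have e : Nat.card {f : ι → Ω | ∀ i, f i ∈ E i} = ∏ i, Nat.card (E i) := by
    rw [← Nat.card_pi]
    exact Nat.card_congr (Equiv.subtypePiEquivPi (p := fun i x => x ∈ E i))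
  simp only [uniformProb, Finset.prod_div_distrib]
  rw [e, Nat.card_pi]
  push_cast
  rfl

end SPTGNN

theorem mainTheorem7 (c δ : ℝ) (hc : 0 < c) (hδ0 : 0 < δ) (hδ1 : δ < 1) :
    ∃ C : ℝ, 0 < C ∧
      ∀ (N T D K k S : ℕ) (ε : ℝ) (G : SPTGNN.DynGraph N T D)
        (P : Fin (K + 1) → Polynomial ℝ) (Θ : Fin D → Fin (K + 1) → ℝ)
        (F : SPTGNN.OrthogonalProjector T)
        (H : Fin D → Matrix (Fin N) (Fin T) ℝ)
        (svd : ∀ d : Fin D, SPTGNN.SVD (F.spectral (H d))),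
        0 < ε → ε ≤ 1 →
        -- accurate node embeddings in each snapshot
        (∀ (d : Fin D) (t : Fin T) (n : Fin N), G.nodeEmbedding P (Θ d) d n t = H d n t) →
        (∀ d : Fin D, (svd d).coherence k ≤ c * k / T) →
        S ≤ T → C * (k : ℝ) ^ 2 / ε ^ 2 ≤ S →
        (∀ d : Fin D,
          1 - δ ≤ SPTGNN.uniformProb {I : SPTGNN.Mask S T |
            G.Expressive P (Θ d) F (H d) d
              ((1 + ε) * ‖F.spectral (H d) - (svd d).truncate k‖ / √F.scale) I}) ∧
        (1 - δ) ^ D ≤ SPTGNN.uniformProb {I : Fin D → SPTGNN.Mask S T |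
          ∀ d : Fin D, G.Expressive P (Θ d) F (H d) d
            ((1 + ε) * ‖F.spectral (H d) - (svd d).truncate k‖ / √F.scale) (I d)} := by
  refine ⟨8 * c / δ, by positivity, ?_⟩
  intro N T D K k S ε G P Θ F H svd hε hε1 hacc hcoh hST hS
  have hH : ∀ d, G.nodeEmbedding P (Θ d) d = H d := fun d => by
    ext n t
    exact hacc d t n
  have hprob : ∀ d, 1 - δ ≤ SPTGNN.uniformProb {I : SPTGNN.Mask S T |
      G.Expressive P (Θ d) F (H d) d
        ((1 + ε) * ‖F.spectral (H d) - (svd d).truncate k‖ / √F.scale) I} := fun d =>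
    ((svd d).uniformProb_columnSelection hc hδ0 hε hε1 (hcoh d) hST hS).trans
      (SPTGNN.uniformProb_mono fun _ hI =>
        G.expressive_of_norm_sub_le P (Θ d) F (H d) d (hH d) hI)
  refine ⟨hprob, ?_⟩
  have hpi := SPTGNN.uniformProb_pi fun d : Fin D => {I : SPTGNN.Mask S T |
    G.Expressive P (Θ d) F (H d) d
      ((1 + ε) * ‖F.spectral (H d) - (svd d).truncate k‖ / √F.scale) I}
  simp only [Set.mem_ofPred_eq] at hpi
  rw [hpi]
  calc (1 - δ) ^ D = ∏ _d : Fin D, (1 - δ) := by simp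
    -- Here `δ < 1` keeps the factors nonnegative.
    _ ≤ _ := Finset.prod_le_prod (fun _ _ => by linarith) fun d _ => hprob d
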